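/- For a finite index set $I$, let $\mathfrak{L}^{I}$ be the set of behaviors $\mathfrak{B}=\{w\in C^\infty(\mathbb{R},\mathbb{R}^{I}) : R(\tfrac{d}{dt})w=0\}$ with $R$ a real polynomial matrix with at least one row and with columns indexed by $I$ (linear differential systems); a number $n$ written as an exponent stands for an index set with $n$ elements. Let $L\in\mathbb{N}$. For $i=1,\dots,L$ let $\mathcal{P}_i\in\mathfrak{L}^{\mathtt{w}_i+\mathtt{s}_i+\mathtt{c}_i}$ be a plant subsystem with variables $(w_i,s_i,c_i)$, and let $\mathcal{K}_i\in\mathfrak{L}^{\mathtt{w}_i+\mathtt{k}_i}$ be a behavior with variables $(w_i,k_i)$. The connection variables are partitioned as $s_i=(s_{ij})_{j}$, $k_i=(k_{ij})_{j}$, where $s_{ij}=s_{ji}$ (with $\mathtt{s}_{ij}=\mathtt{s}_{ji}\ge 0$ components) is shared by $\mathcal{P}_i$ and $\mathcal{P}_j$, and $k_{ij}=k_{ji}$ (with $\mathtt{k}_{ij}=\mathtt{k}_{ji}\ge 0$ components) is shared by $\mathcal{K}_i$ and $\mathcal{K}_j$. The desired behavior respects the interconnection structure of the plant: $\mathtt{s}_{ij}=0\Rightarrow\mathtt{k}_{ij}=0$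 for all $i,j$. Put $$\mathcal{P}_\mathcal{I}=\{(w,s,c) : (w_i,s_i,c_i)\in\mathcal{P}_i\ \forall i\},\qquad \mathcal{K}_\mathcal{I}=\{(w,k) : (w_i,k_i)\in\mathcal{K}_i\ \forall i\},$$ let $(\cdot)_w$ denote the projection of a behavior onto the variable $w=(w_1,\dots,w_L)$, and let $\mathcal{N}(\mathcal{P}_\mathcal{I})=\{w : \exists s,\ (w,s,0)\in\mathcal{P}_\mathcal{I}\}$ be the hidden behavior. Local controllers $\mathcal{C}_i$, with variables $(c_i,p_i)$ and $p_i=(p_{ij})_j$, $p_{ij}=p_{ji}$ having $\mathtt{p}_{ij}=\mathtt{p}_{ji}\ge0$ components, are said to implement $\mathcal{K}_\mathcal{I}$ if $$(\mathcal{K}_\mathcal{I})_w=\{w : \exists\, s,c,p \text{ such that } (w,s,c)\in\mathcal{P}_\mathcal{I}\text{ and }(c_i,p_i)\in\mathcal{C}_i\ \forall i\}.$$ $\mathcal{K}_\mathcal{I}$ is called implementable via distributed control if it is implemented by some $\mathcal{C}_i\in\mathfrak{L}^{\mathtt{c}_i+\mathtt{p}_i}$, $i=1,\dots,L$, with $\mathtt{s}_{ij}=0\Rightarrow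 \mathtt{p}_{ij}=0$ for all $i,j$. The canonical distributed controller consists of the local controllers $$\mathcal{C}_i^{\mathrm{can}}=\{(c_i,s_i,k_i) : \exists\, w_i,\ (w_i,s_i,c_i)\in\mathcal{P}_i\text{ and }(w_i,k_i)\in\mathcal{K}_i\},$$ interconnected through $p_{ij}=(s_{ij},k_{ij})$. Then $\mathcal{K}_\mathcal{I}$ is implementable via distributed control if and only if the canonical distributed controller implements $\mathcal{K}_\mathcal{I}$. Consequently, $\mathcal{K}_\mathcal{I}$ is implementable via distributed control if and only if $$\mathcal{N}(\mathcal{P}_\mathcal{I})\subseteq(\mathcal{K}_\mathcal{I})_w\subseteq(\mathcal{P}_\mathcal{I})_w .$$ -/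

import Mathlib

open Polynomial
open scoped ContDiff

namespace DistributedBehavior

/-! ## Linear differential systems -/

/-- Time trajectories `ℝ → ℝ^ι` of a list of variables indexed by `ι`. -/
abbrev Traj (ι : Type) : Type := ℝ → ι → ℝ

/-- The scalar differential operator `p(d/dt)` applied to a scalar function `f`. -/
noncomputable def polyDiff (p : ℝ[X]) (f : ℝ → ℝ) : ℝ → ℝ :=
  fun t => p.sum fun n a => a * iteratedDeriv n f t

/-- The behavior `{w ∈ C^∞(ℝ, ℝ^ι) | R(d/dt) w = 0}` of a polynomial matrix `R`. -/
def kernelBehavior {g : ℕ} {ι : Type} [Fintype ι] (R : Matrix (Fin g) ι ℝ[X]) : Set (Traj ι) :=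
  {w | ContDiff ℝ ∞ w ∧
    ∀ (a : Fin g) (t : ℝ), ∑ j, polyDiff (R a j) (fun τ => w τ j) t = 0}

/-- `B` is the behavior of a linear differential system in the variables indexed by `ι`. -/
def IsLinearDifferential {ι : Type} [Fintype ι] (B : Set (Traj ι)) : Prop :=
  ∃ g : ℕ, 0 < g ∧ ∃ R : Matrix (Fin g) ι ℝ[X], B = kernelBehavior R

/-- The joint trajectory `(v, v')`. -/
def join {ι κ : Type} (v : Traj ι) (v' : Traj κ) : Traj (ι ⊕ κ) :=
  fun t => Sum.elim (v t) (v' t)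

/-! ## Interconnections of `L` subsystems

The connection variable shared by subsystems `i` and `j` belongs to the unordered pair `s(i, j)`,
so that the one seen by `i` and the one seen by `j` are the same variable. Its number of
components is `n s(i, j)`; it is absent if this number is zero. -/

/-- Index set of the components of all connection variables of subsystem `i`. -/
abbrev Conn {L : ℕ} (n : Sym2 (Fin L) → ℕ) (i : Fin L) : Type :=
  (j : Fin L) × Fin (n s(i, j))

/-- The connection variable of subsystem `i`: all variables that `i` shares with some `j`. -/
def connAt {L : ℕ} {n : Sym2 (Fin L) → ℕ} (s : ∀ e, Traj (Fin (n e))) (i : Fin L) :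
    Traj (Conn n i) :=
  fun t x => s s(i, x.1) t x.2

/-- The interconnection of behaviors `B i`, with trajectories `(v i, r i)`, through their connection
variables `r i`. -/
def interconnect {L : ℕ} {m : Fin L → ℕ} {n : Sym2 (Fin L) → ℕ}
    (B : ∀ i, Set (Traj (Fin (m i) ⊕ Conn n i))) :
    Set ((∀ i, Traj (Fin (m i))) × (∀ e, Traj (Fin (n e)))) :=
  {x | ∀ i, join (x.1 i) (connAt x.2 i) ∈ B i}

/-- The interconnected plant: all `(w, s, c)` with `(w i, s i, c i) ∈ P i` for all `i`. -/
def plantInterconnect {L : ℕ} {nw nc : Fin L → ℕ} {ns : Sym2 (Fin L) → ℕ}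
    (P : ∀ i, Set (Traj (Fin (nw i) ⊕ (Conn ns i ⊕ Fin (nc i))))) :
    Set ((∀ i, Traj (Fin (nw i))) × (∀ e, Traj (Fin (ns e))) × (∀ i, Traj (Fin (nc i)))) :=
  {x | ∀ i, join (x.1 i) (join (connAt x.2.1 i) (x.2.2 i)) ∈ P i}

/-- The manifest behavior of an interconnection: its connection variables are eliminated. -/
def manifest {α β : Type} (B : Set (α × β)) : Set α :=
  {v | ∃ r, (v, r) ∈ B}

/-- The manifest behavior of the interconnected plant with respect to `(w, c)`. -/
def plantManifestWC {L : ℕ} {nw nc : Fin L → ℕ} {ns : Sym2 (Fin L) → ℕ}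
    (P : ∀ i, Set (Traj (Fin (nw i) ⊕ (Conn ns i ⊕ Fin (nc i))))) :
    Set ((∀ i, Traj (Fin (nw i))) × (∀ i, Traj (Fin (nc i)))) :=
  {x | ∃ s, (x.1, s, x.2) ∈ plantInterconnect P}

/-- The hidden behavior of the interconnected plant: all `w` that are compatible with `c = 0`. -/
def hidden {L : ℕ} {nw nc : Fin L → ℕ} {ns : Sym2 (Fin L) → ℕ}
    (P : ∀ i, Set (Traj (Fin (nw i) ⊕ (Conn ns i ⊕ Fin (nc i))))) :
    Set (∀ i, Traj (Fin (nw i))) :=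
  {w | (w, 0) ∈ plantManifestWC P}

/-! ## Distributed control -/

/-- The controlled interconnection: the interconnected plant and the interconnected controller
share the control variable `c`. Its trajectories are `(w, s, c, p)`. -/
def controlled {L : ℕ} {nw nc : Fin L → ℕ} {ns np : Sym2 (Fin L) → ℕ}
    (P : ∀ i, Set (Traj (Fin (nw i) ⊕ (Conn ns i ⊕ Fin (nc i)))))
    (C : ∀ i, Set (Traj (Fin (nc i) ⊕ Conn np i))) :
    Set ((∀ i, Traj (Fin (nw i))) × (∀ e, Traj (Fin (ns e))) ×
      (∀ i, Traj (Fin (nc i))) × (∀ e, Traj (Fin (np e)))) :=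
  {x | (x.1, x.2.1, x.2.2.1) ∈ plantInterconnect P ∧ (x.2.2.1, x.2.2.2) ∈ interconnect C}

/-- The local controllers `C i`, interconnected with each other, implement the desired behavior
given by the interconnection of the behaviors `K i`: the controlled interconnection and the desired
interconnection have the same manifest behavior with respect to `w`. -/
def Implements {L : ℕ} {nw nc : Fin L → ℕ} {ns nk np : Sym2 (Fin L) → ℕ}
    (P : ∀ i, Set (Traj (Fin (nw i) ⊕ (Conn ns i ⊕ Fin (nc i)))))
    (K : ∀ i, Set (Traj (Fin (nw i) ⊕ Conn nk i)))
    (C : ∀ i, Set (Traj (Fin (nc i) ⊕ Conn np i))) : Prop :=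
  manifest (interconnect K) = manifest (controlled P C)

/-- The desired behavior is implementable via distributed control: it is implemented by linear
differential local controllers, two of which share variables only if the corresponding plant
subsystems do. -/
def ImplementableViaDistributedControl {L : ℕ} {nw nc : Fin L → ℕ} {ns nk : Sym2 (Fin L) → ℕ}
    (P : ∀ i, Set (Traj (Fin (nw i) ⊕ (Conn ns i ⊕ Fin (nc i)))))
    (K : ∀ i, Set (Traj (Fin (nw i) ⊕ Conn nk i))) : Prop :=
  ∃ np : Sym2 (Fin L) → ℕ, (∀ i j, ns s(i, j) = 0 → np s(i, j) = 0) ∧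
    ∃ C : ∀ i, Set (Traj (Fin (nc i) ⊕ Conn np i)),
      (∀ i, IsLinearDifferential (C i)) ∧ Implements P K C

/-- The local canonical controller of subsystem `i`: all `(c i, s i, k i)` for which there is a
`w i` with `(w i, s i, c i) ∈ P i` and `(w i, k i) ∈ K i`. The variable that it shares with
the controller of subsystem `j` is the pair of `s i j` (first components) and `k i j` (last
components). -/
def canonicalLocal {L : ℕ} {nw nc : Fin L → ℕ} {ns nk : Sym2 (Fin L) → ℕ}
    (P : ∀ i, Set (Traj (Fin (nw i) ⊕ (Conn ns i ⊕ Fin (nc i)))))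
    (K : ∀ i, Set (Traj (Fin (nw i) ⊕ Conn nk i))) (i : Fin L) :
    Set (Traj (Fin (nc i) ⊕ Conn (fun e => ns e + nk e) i)) :=
  {v | ∃ w : Traj (Fin (nw i)),
    join w (join (fun t x => v t (Sum.inr ⟨x.1, Fin.castAdd (nk s(i, x.1)) x.2⟩))
      (fun t a => v t (Sum.inl a))) ∈ P i ∧
    join w (fun t x => v t (Sum.inr ⟨x.1, Fin.natAdd (ns s(i, x.1)) x.2⟩)) ∈ K i}

end DistributedBehavior

namespace DistributedBehavior

/-! ## Smooth functions as a module over differential operators -/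

/-- The smooth functions `ℝ → 𝕜`. -/
def smoothFunctions (𝕜 : Type) [RCLike 𝕜] : Submodule 𝕜 (ℝ → 𝕜) where
  carrier := {f | ContDiff ℝ ∞ f}
  add_mem' hf hg := Set.mem_ofPred.2 ((Set.mem_ofPred.1 hf).add (Set.mem_ofPred.1 hg))
  zero_mem' := Set.mem_ofPred.2 contDiff_zero_fun
  smul_mem' _ _ hf := Set.mem_ofPred.2 (contDiff_const.mul (Set.mem_ofPred.1 hf))

theorem smoothFunctions.contDiff {𝕜 : Type} [RCLike 𝕜] (f : smoothFunctions 𝕜) :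
    ContDiff ℝ ∞ f.1 := f.2

/-- Differentiation as an endomorphism of the space of smooth functions. -/
noncomputable def derivative (𝕜 : Type) [RCLike 𝕜] :
    smoothFunctions 𝕜 →ₗ[𝕜] smoothFunctions 𝕜 where
  toFun f := ⟨deriv f.1, (contDiff_infty_iff_deriv.1 f.2).2⟩
  map_add' f g := by
    ext t
    exact deriv_add ((contDiff_infty_iff_deriv.1 f.2).1 t) ((contDiff_infty_iff_deriv.1 g.2).1 t)
  map_smul' c f := by
    ext t
    exact deriv_const_mul c ((contDiff_infty_iff_deriv.1 f.2).1 t)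

theorem derivative_pow_apply {𝕜 : Type} [RCLike 𝕜] (n : ℕ) (f : smoothFunctions 𝕜) :
    ((derivative 𝕜 ^ n) f).1 = iteratedDeriv n f.1 := by
  induction n with
  | zero => simp
  | succ n ih =>
    rw [pow_succ', iteratedDeriv_succ, ← ih]
    rfl

theorem aeval_derivative_apply (p : ℝ[X]) (f : smoothFunctions ℝ) (t : ℝ) :
    (aeval (derivative ℝ) p f).1 t = polyDiff p f.1 t := by
  rw [aeval_eq_sum_range, polyDiff, Polynomial.sum_over_range _ (by simp)]
  simp [LinearMap.sum_apply, derivative_pow_apply]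

/-- Variation of constants: `f t = exp (z t) ∫₀ᵗ exp (-z s) y s ds` solves `f' - z f = y`. -/
theorem derivative_sub_algebraMap_surjective (z : ℂ) :
    Function.Surjective (derivative ℂ - algebraMap ℂ (Module.End ℂ (smoothFunctions ℂ)) z) := by
  intro y
  have hy : ContDiff ℝ ∞ y.1 := y.2
  set g : ℝ → ℂ := fun t => Complex.exp (-z * t) * y.1 t with hg
  have hofReal : ContDiff ℝ ∞ (fun t : ℝ => (t : ℂ)) := Complex.ofRealCLM.contDiff
  have hg' : ContDiff ℝ ∞ g := ((contDiff_const.mul hofReal).cexp).mul hy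
  set G : ℝ → ℂ := fun t => ∫ s in (0 : ℝ)..t, g s with hG
  have hGd : ∀ t, HasDerivAt G (g t) t := fun t =>
    intervalIntegral.integral_hasDerivAt_right (hg'.continuous.intervalIntegrable _ _)
      hg'.continuous.aestronglyMeasurable.stronglyMeasurableAtFilter hg'.continuous.continuousAt
  have hGs : ContDiff ℝ ∞ G := by
    rw [contDiff_infty_iff_deriv]
    refine ⟨fun t => (hGd t).differentiableAt, ?_⟩
    rwa [show deriv G = g from funext fun t => (hGd t).deriv]
  have hE : ∀ t : ℝ, HasDerivAt (fun t : ℝ => Complex.exp (z * t)) (Complex.exp (z * t) * z) t := by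
    intro t
    have h := ((hasDerivAt_id t).ofReal_comp.const_mul z).cexp
    simpa using h
  refine ⟨⟨fun t => Complex.exp (z * t) * G t, ((contDiff_const.mul hofReal).cexp).mul hGs⟩, ?_⟩
  ext t
  change deriv (fun t : ℝ => Complex.exp (z * t) * G t) t - z * (Complex.exp (z * t) * G t) = y.1 t
  rw [show deriv (fun t : ℝ => Complex.exp (z * t) * G t) t = _ from
    ((hE t).mul (hGd t)).deriv, hg]
  have : Complex.exp (z * t) * Complex.exp (-z * t) = 1 := by
    rw [← Complex.exp_add]; simp
  linear_combination y.1 t * this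

/-- Over `ℂ` the operator splits into first-order factors, each surjective. -/
theorem aeval_derivative_complex_surjective {p : ℂ[X]} (hp : p ≠ 0) :
    Function.Surjective (aeval (derivative ℂ) p) := by
  have key : ∀ s : Multiset ℂ, Function.Surjective
      (aeval (derivative ℂ) (s.map fun a => X - C a).prod) := by
    intro s
    induction s using Multiset.induction with
    | empty => intro y; exact ⟨y, by simp⟩
    | cons a s ih =>
      rw [Multiset.map_cons, Multiset.prod_cons, map_mul, Module.End.mul_eq_comp,
        LinearMap.coe_comp]
      refine Function.Surjective.comp ?_ ih
      simpa using derivative_sub_algebraMap_surjective a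
  intro y
  obtain ⟨f, hf⟩ := key p.roots (p.leadingCoeff⁻¹ • y)
  refine ⟨f, ?_⟩
  rw [(IsAlgClosed.splits p).eq_prod_roots, map_mul, Module.End.mul_apply, hf]
  simp [smul_smul, hp]

/-- The real part of a smooth complex function. -/
noncomputable def rePart : smoothFunctions ℂ →ₗ[ℝ] smoothFunctions ℝ where
  toFun f := ⟨fun t => (f.1 t).re, Complex.reCLM.contDiff.comp (smoothFunctions.contDiff f)⟩
  map_add' f g := by ext t; simp
  map_smul' c f := by ext t; simp

theorem rePart_derivative (f : smoothFunctions ℂ) :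
    rePart (derivative ℂ f) = derivative ℝ (rePart f) := by
  ext t
  have h := ((contDiff_infty_iff_deriv.1 f.2).1 t).hasDerivAt
  exact (Complex.reCLM.hasFDerivAt.comp_hasDerivAt t h).deriv.symm

theorem rePart_aeval_derivative (p : ℝ[X]) (f : smoothFunctions ℂ) :
    rePart (aeval (derivative ℂ) (p.map (algebraMap ℝ ℂ)) f) =
      aeval (derivative ℝ) p (rePart f) := by
  induction p using Polynomial.induction_on generalizing f with
  | C a =>
    ext t
    simp [rePart]
  | add p q hp hq => simp only [Polynomial.map_add, map_add, LinearMap.add_apply, hp, hq]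
  | monomial n a ih =>
    rw [pow_succ, ← mul_assoc, Polynomial.map_mul, map_mul, map_mul, Module.End.mul_apply,
      Module.End.mul_apply, ih]
    simp [rePart_derivative]

theorem aeval_derivative_real_surjective {p : ℝ[X]} (hp : p ≠ 0) :
    Function.Surjective (aeval (derivative ℝ) p) := by
  intro y
  have hp' : p.map (algebraMap ℝ ℂ) ≠ 0 := by
    rwa [Ne, Polynomial.map_eq_zero]
  -- Solve over `ℂ`; real coefficients commute with taking real parts.
  obtain ⟨f, hf⟩ := aeval_derivative_complex_surjective hp'
    ⟨fun t => (y.1 t : ℂ), Complex.ofRealCLM.contDiff.comp (smoothFunctions.contDiff y)⟩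
  refine ⟨rePart f, ?_⟩
  rw [← rePart_aeval_derivative, hf]
  ext t
  simp [rePart]

/-- The smooth real functions are a module over the ring of differential operators `ℝ[d/dt]`. -/
noncomputable instance : Module ℝ[X] (smoothFunctions ℝ) :=
  Module.compHom _ (aeval (derivative ℝ)).toRingHom

theorem polynomial_smul_eq (p : ℝ[X]) (f : smoothFunctions ℝ) :
    p • f = aeval (derivative ℝ) p f := rfl

/-- A divisible module over a principal ideal domain is injective. -/
theorem baer_of_divisible {A M : Type*} [CommRing A] [IsDomain A] [IsPrincipalIdealRing A]
    [AddCommGroup M] [Module A M] (h : ∀ a : A, a ≠ 0 → ∀ m : M, ∃ m', a • m' = m) :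
    Module.Baer A M := by
  intro I g
  obtain ⟨a, rfl⟩ := (IsPrincipalIdealRing.principal I).principal
  by_cases ha : a = 0
  · subst ha
    refine ⟨0, fun x hx => ?_⟩
    have : (⟨x, hx⟩ : Submodule.span A {(0 : A)}) = 0 := by
      ext; simpa using hx
    rw [this]; simp
  -- Dividing `g a` by the generator `a` gives the value at `1` of the extension.
  · obtain ⟨m, hm⟩ := h a ha (g ⟨a, Submodule.mem_span_singleton_self a⟩)
    refine ⟨LinearMap.toSpanSingleton A M m, fun x hx => ?_⟩
    obtain ⟨b, rfl⟩ := Submodule.mem_span_singleton.1 hx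
    have : (⟨b • a, hx⟩ : Submodule.span A {a}) =
        b • ⟨a, Submodule.mem_span_singleton_self a⟩ := rfl
    rw [this, map_smul g, ← hm, LinearMap.toSpanSingleton_apply, smul_smul, smul_eq_mul]

theorem smoothFunctions_injective : Module.Injective ℝ[X] (smoothFunctions ℝ) :=
  (baer_of_divisible fun _ hp m => aeval_derivative_real_surjective hp m).injective

/-! ## Behaviors and submodules of equations -/

/-- The trajectory whose components are given smooth functions. -/
def toTraj {ι : Type} (F : ι → smoothFunctions ℝ) : Traj ι :=
  fun t j => (F j).1 t

theorem toTraj_injective {ι : Type} : Function.Injective (toTraj (ι := ι)) := by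
  intro F G h
  funext j
  ext t
  exact congrFun (congrFun h t) j

theorem contDiff_iff_exists_toTraj {ι : Type} [Fintype ι] (x : Traj ι) :
    ContDiff ℝ ∞ x ↔ ∃ F, toTraj F = x := by
  rw [contDiff_pi]
  constructor
  · intro h
    exact ⟨fun j => ⟨fun t => x t j, h j⟩, by
      funext t j; simp [toTraj]⟩
  · rintro ⟨F, rfl⟩ j
    exact (F j).2

/-- The behavior of all smooth trajectories that satisfy a given module of equations. -/
def solutions {ι : Type} (S : Submodule ℝ[X] (ι →₀ ℝ[X])) : Set (Traj ι) :=
  toTraj '' {F | S ≤ LinearMap.ker (Finsupp.linearCombination ℝ[X] F)}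

theorem toTraj_mem_solutions {ι : Type} {S : Submodule ℝ[X] (ι →₀ ℝ[X])} {F : ι → smoothFunctions ℝ} :
    toTraj F ∈ solutions S ↔ S ≤ LinearMap.ker (Finsupp.linearCombination ℝ[X] F) :=
  toTraj_injective.mem_set_image

/-- A behavior depends only on the row module of `R`, which replaces matrices by submodules. -/
theorem kernelBehavior_eq_solutions {g : ℕ} {ι : Type} [Fintype ι] (R : Matrix (Fin g) ι ℝ[X]) :
    kernelBehavior R =
      solutions (Submodule.span ℝ[X] (Set.range fun a => Finsupp.equivFunOnFinite.symm (R a))) := by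
  have key : ∀ F : ι → smoothFunctions ℝ, (∀ (a : Fin g) (t : ℝ),
      ∑ j, polyDiff (R a j) (fun τ => toTraj F τ j) t = 0) ↔
      Submodule.span ℝ[X] (Set.range fun a => Finsupp.equivFunOnFinite.symm (R a)) ≤
        LinearMap.ker (Finsupp.linearCombination ℝ[X] F) := by
    intro F
    rw [Submodule.span_le, Set.range_subset_iff]
    refine forall_congr' fun a => ?_
    have hsum : Finsupp.linearCombination ℝ[X] F (Finsupp.equivFunOnFinite.symm (R a)) =
        ∑ j, R a j • F j := by
      rw [Finsupp.linearCombination_apply, Finsupp.sum_fintype _ _ (by simp)]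
      rfl
    rw [SetLike.mem_coe, LinearMap.mem_ker, hsum,
      ← Subtype.coe_inj, funext_iff]
    refine forall_congr' fun t => ?_
    simp [polynomial_smul_eq, aeval_derivative_apply, toTraj]
  ext x
  constructor
  · rintro ⟨hx, h⟩
    obtain ⟨F, rfl⟩ := (contDiff_iff_exists_toTraj x).1 hx
    exact ⟨F, (key F).1 h, rfl⟩
  · rintro ⟨F, hF, rfl⟩
    exact ⟨(contDiff_iff_exists_toTraj _).2 ⟨F, rfl⟩, (key F).2 hF⟩

theorem isLinearDifferential_iff {ι : Type} [Fintype ι] {B : Set (Traj ι)} :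
    IsLinearDifferential B ↔ ∃ S, B = solutions S := by
  constructor
  · rintro ⟨g, -, R, rfl⟩
    exact ⟨_, kernelBehavior_eq_solutions R⟩
  · rintro ⟨S, rfl⟩
    obtain ⟨n, s, hs⟩ := Submodule.fg_iff_exists_fin_generating_family.1 (IsNoetherian.noetherian S)
    -- The extra zero row guarantees at least one row and leaves the span unchanged.
    let s₀ : Fin (n + 1) → ι →₀ ℝ[X] := Fin.cons 0 s
    let R : Matrix (Fin (n + 1)) ι ℝ[X] := Matrix.of fun a => s₀ a
    have hR : (fun a => Finsupp.equivFunOnFinite.symm (R a)) = s₀ :=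
      funext fun a => Finsupp.equivFunOnFinite.symm_apply_apply (s₀ a)
    refine ⟨n + 1, n.succ_pos, R, ?_⟩
    rw [kernelBehavior_eq_solutions, hR, Fin.range_cons, Submodule.span_insert_zero, hs]

/-- A linear map into an injective module that kills the preimage of `S` under `e` extends along `e`
to a linear map that kills `S`. -/
theorem exists_extension_of_comap_le_ker {A X Y M : Type} [CommRing A] [AddCommGroup X] [Module A X]
    [AddCommGroup Y] [Module A Y] [AddCommGroup M] [Module A M] [Module.Injective A M]
    (S : Submodule A Y) (e : X →ₗ[A] Y) (f : X →ₗ[A] M) (hf : S.comap e ≤ LinearMap.ker f) :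
    ∃ h : Y →ₗ[A] M, S ≤ LinearMap.ker h ∧ ∀ x, h (e x) = f x := by
  have hi : Function.Injective ((S.comap e).mapQ S e le_rfl) := by
    rw [← LinearMap.ker_eq_bot, Submodule.ker_mapQ, Submodule.mkQ_map_self]
  obtain ⟨h, hh⟩ := Module.Injective.out _ hi ((S.comap e).liftQ f hf)
  refine ⟨h ∘ₗ S.mkQ, fun x hx => ?_, fun x => hh ((S.comap e).mkQ x)⟩
  rw [LinearMap.mem_ker, LinearMap.comp_apply, Submodule.mkQ_apply,
    (Submodule.Quotient.mk_eq_zero S).2 hx, map_zero]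

/-- Elimination: the projection of a linear differential behavior is linear differential. -/
theorem IsLinearDifferential.eliminate {ι κ : Type} [Fintype ι] [Fintype κ]
    {B : Set (Traj (ι ⊕ κ))} (hB : IsLinearDifferential B) :
    IsLinearDifferential {v : Traj ι | ∃ l : Traj κ, join v l ∈ B} := by
  obtain ⟨S, rfl⟩ := isLinearDifferential_iff.1 hB
  let e : (ι →₀ ℝ[X]) →ₗ[ℝ[X]] (ι ⊕ κ →₀ ℝ[X]) := Finsupp.lmapDomain ℝ[X] ℝ[X] Sum.inl
  -- The projection obeys exactly those equations of `S` that involve only the retained variables.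
  refine isLinearDifferential_iff.2 ⟨S.comap e, ?_⟩
  ext v
  constructor
  · rintro ⟨l, F, hF, hv⟩
    refine ⟨F ∘ Sum.inl, fun x hx => ?_, ?_⟩
    · have h := hF (Submodule.mem_comap.1 hx)
      rw [LinearMap.mem_ker] at h ⊢
      rw [← h, ← LinearMap.comp_apply, Finsupp.linearCombination_comp_lmapDomain]
    · funext t a
      exact congrFun (congrFun hv t) (Sum.inl a)
  · rintro ⟨F, hF, rfl⟩
    have := smoothFunctions_injective
    -- The values of the extension `h` on the remaining basis vectors are the eliminated components.
    obtain ⟨h, hS, hh⟩ := exists_extension_of_comap_le_ker S e _ hF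
    let H : ι ⊕ κ → smoothFunctions ℝ := fun j => h (Finsupp.single j 1)
    have hH : Finsupp.linearCombination ℝ[X] H = h := by
      ext j
      simp [H]
    have hHF : ∀ a, H (Sum.inl a) = F a := by
      intro a
      have := hh (Finsupp.single a 1)
      simpa [e, H] using this
    refine ⟨toTraj (H ∘ Sum.inr), H, fun x hx => ?_, ?_⟩
    · rw [hH]
      exact hS hx
    · funext t j
      rcases j with a | b
      · simp [toTraj, join, hHF]
      · rfl

/-- The trajectories two relabelings of which, together covering all components, lie in given
linear differential behaviors form a linear differential behavior. -/
theorem IsLinearDifferential.relabel_inter {ι₁ ι₂ κ : Type} [Fintype ι₁] [Fintype ι₂] [Fintype κ]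
    {B₁ : Set (Traj ι₁)} {B₂ : Set (Traj ι₂)} (h₁ : IsLinearDifferential B₁)
    (h₂ : IsLinearDifferential B₂) (σ : ι₁ → κ) (τ : ι₂ → κ)
    (hστ : ∀ k, (∃ a, σ a = k) ∨ ∃ b, τ b = k) :
    IsLinearDifferential {x : Traj κ | (fun t a => x t (σ a)) ∈ B₁ ∧ (fun t b => x t (τ b)) ∈ B₂} := by
  obtain ⟨S₁, rfl⟩ := isLinearDifferential_iff.1 h₁
  obtain ⟨S₂, rfl⟩ := isLinearDifferential_iff.1 h₂
  refine isLinearDifferential_iff.2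
    ⟨S₁.map (Finsupp.lmapDomain ℝ[X] ℝ[X] σ) ⊔ S₂.map (Finsupp.lmapDomain ℝ[X] ℝ[X] τ), ?_⟩
  have key : ∀ F : κ → smoothFunctions ℝ,
      ((fun t a => toTraj F t (σ a)) ∈ solutions S₁ ∧ (fun t b => toTraj F t (τ b)) ∈ solutions S₂) ↔
        S₁.map (Finsupp.lmapDomain ℝ[X] ℝ[X] σ) ⊔ S₂.map (Finsupp.lmapDomain ℝ[X] ℝ[X] τ) ≤
          LinearMap.ker (Finsupp.linearCombination ℝ[X] F) := by
    intro F
    rw [sup_le_iff, Submodule.map_le_iff_le_comap, Submodule.map_le_iff_le_comap,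
      ← LinearMap.ker_comp, ← LinearMap.ker_comp, Finsupp.linearCombination_comp_lmapDomain,
      Finsupp.linearCombination_comp_lmapDomain, ← toTraj_mem_solutions, ← toTraj_mem_solutions]
    rfl
  ext x
  constructor
  · rintro ⟨⟨F₁, hF₁, e₁⟩, ⟨F₂, hF₂, e₂⟩⟩
    -- Covering is needed here: a component reached by neither map could fail to be smooth.
    have hx : ContDiff ℝ ∞ x := by
      rw [contDiff_pi]
      intro k
      rcases hστ k with ⟨a, rfl⟩ | ⟨b, rfl⟩
      · exact contDiff_pi.1 ((contDiff_iff_exists_toTraj _).2 ⟨F₁, e₁⟩) a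
      · exact contDiff_pi.1 ((contDiff_iff_exists_toTraj _).2 ⟨F₂, e₂⟩) b
    obtain ⟨F, rfl⟩ := (contDiff_iff_exists_toTraj x).1 hx
    exact toTraj_mem_solutions.2 ((key F).1 ⟨⟨F₁, hF₁, e₁⟩, ⟨F₂, hF₂, e₂⟩⟩)
  · rintro ⟨F, hF, rfl⟩
    exact (key F).2 hF

/-! ### Linearity of behaviors -/

theorem IsLinearDifferential.zero_mem {ι : Type} [Fintype ι] {B : Set (Traj ι)}
    (hB : IsLinearDifferential B) : 0 ∈ B := by
  obtain ⟨S, rfl⟩ := isLinearDifferential_iff.1 hB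
  refine ⟨0, fun x _ => ?_, ?_⟩
  · simp
  · funext t j
    simp [toTraj]

theorem IsLinearDifferential.sub_mem {ι : Type} [Fintype ι] {B : Set (Traj ι)}
    (hB : IsLinearDifferential B) {x y : Traj ι} (hx : x ∈ B) (hy : y ∈ B) : x - y ∈ B := by
  obtain ⟨S, rfl⟩ := isLinearDifferential_iff.1 hB
  obtain ⟨F, hF, rfl⟩ := hx
  obtain ⟨G, hG, rfl⟩ := hy
  refine ⟨F - G, fun x hx => ?_, ?_⟩
  · have h₁ := hF hx
    have h₂ := hG hx
    rw [LinearMap.mem_ker, Finsupp.linearCombination_apply] at h₁ h₂ ⊢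
    rw [Finsupp.sum] at h₁ h₂ ⊢
    simp only [Pi.sub_apply, smul_sub, Finset.sum_sub_distrib, h₁, h₂, sub_zero]
  · funext t j
    simp [toTraj]

theorem IsLinearDifferential.add_mem {ι : Type} [Fintype ι] {B : Set (Traj ι)}
    (hB : IsLinearDifferential B) {x y : Traj ι} (hx : x ∈ B) (hy : y ∈ B) : x + y ∈ B := by
  simpa using hB.sub_mem hx (hB.sub_mem hB.zero_mem hy)

/-! ## Distributed control -/

theorem join_add {ι κ : Type} (v w : Traj ι) (v' w' : Traj κ) :
    join (v + w) (v' + w') = join v v' + join w w' := by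
  funext t j; cases j <;> rfl

theorem join_sub {ι κ : Type} (v w : Traj ι) (v' w' : Traj κ) :
    join (v - w) (v' - w') = join v v' - join w w' := by
  funext t j; cases j <;> rfl

theorem join_zero {ι κ : Type} : join (0 : Traj ι) (0 : Traj κ) = 0 := by
  funext t j; cases j <;> rfl

section Control

variable {L : ℕ} {nw nc : Fin L → ℕ} {ns nk : Sym2 (Fin L) → ℕ}
  {P : ∀ i, Set (Traj (Fin (nw i) ⊕ (Conn ns i ⊕ Fin (nc i))))}
  {K : ∀ i, Set (Traj (Fin (nw i) ⊕ Conn nk i))}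

theorem isLinearDifferential_canonicalLocal {i : Fin L} (hP : IsLinearDifferential (P i))
    (hK : IsLinearDifferential (K i)) : IsLinearDifferential (canonicalLocal P K i) := by
  let σ : Fin (nw i) ⊕ (Conn ns i ⊕ Fin (nc i)) →
      (Fin (nc i) ⊕ Conn (fun e => ns e + nk e) i) ⊕ Fin (nw i) :=
    Sum.elim Sum.inr (Sum.elim
      (fun x => Sum.inl (Sum.inr ⟨x.1, Fin.castAdd (nk s(i, x.1)) x.2⟩))
      (fun a => Sum.inl (Sum.inl a)))
  let τ : Fin (nw i) ⊕ Conn nk i →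
      (Fin (nc i) ⊕ Conn (fun e => ns e + nk e) i) ⊕ Fin (nw i) :=
    Sum.elim Sum.inr (fun x => Sum.inl (Sum.inr ⟨x.1, Fin.natAdd (ns s(i, x.1)) x.2⟩))
  have hστ : ∀ k, (∃ a, σ a = k) ∨ ∃ b, τ b = k := by
    rintro ((a | ⟨j, x⟩) | b)
    · exact Or.inl ⟨Sum.inr (Sum.inr a), rfl⟩
    · induction x using Fin.addCases with
      | left x => exact Or.inl ⟨Sum.inr (Sum.inl ⟨j, x⟩), rfl⟩
      | right x => exact Or.inr ⟨Sum.inr ⟨j, x⟩, rfl⟩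
    · exact Or.inl ⟨Sum.inl b, rfl⟩
  -- The canonical controller is the plant and desired behavior glued along `w i`, with `w i` then
  -- eliminated.
  convert (hP.relabel_inter hK σ τ hστ).eliminate using 1
  ext v
  refine exists_congr fun w => and_congr (iff_of_eq ?_) (iff_of_eq ?_)
  · congr 1
    funext t j
    rcases j with a | a | a <;> rfl
  · congr 1
    funext t j
    rcases j with a | a <;> rfl

theorem add_mem_manifest_interconnect (hK : ∀ i, IsLinearDifferential (K i))
    {v w : ∀ i, Traj (Fin (nw i))} (hv : v ∈ manifest (interconnect K))
    (hw : w ∈ manifest (interconnect K)) : v + w ∈ manifest (interconnect K) := by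
  obtain ⟨r, hr⟩ := hv
  obtain ⟨r', hr'⟩ := hw
  refine ⟨r + r', fun i => ?_⟩
  have h := (hK i).add_mem (hr i) (hr' i)
  rw [← join_add] at h
  exact h

theorem sub_mem_hidden (hP : ∀ i, IsLinearDifferential (P i)) {v w : ∀ i, Traj (Fin (nw i))}
    {s r : ∀ e, Traj (Fin (ns e))} {c : ∀ i, Traj (Fin (nc i))}
    (hv : (v, s, c) ∈ plantInterconnect P) (hw : (w, r, c) ∈ plantInterconnect P) :
    v - w ∈ hidden P := by
  refine ⟨s - r, fun i => ?_⟩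
  have h := (hP i).sub_mem (hv i) (hw i)
  rw [← join_sub, ← join_sub, sub_self] at h
  exact h

theorem Implements.subset_plant {np : Sym2 (Fin L) → ℕ} {C : ∀ i, Set (Traj (Fin (nc i) ⊕ Conn np i))}
    (h : Implements P K C) :
    manifest (interconnect K) ⊆ manifest (plantInterconnect P) := by
  rw [h]
  rintro w ⟨⟨s, c, p⟩, hw, -⟩
  exact ⟨(s, c), hw⟩

theorem Implements.hidden_subset {np : Sym2 (Fin L) → ℕ} {C : ∀ i, Set (Traj (Fin (nc i) ⊕ Conn np i))}
    (h : Implements P K C) (hC : ∀ i, IsLinearDifferential (C i)) :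
    hidden P ⊆ manifest (interconnect K) := by
  rw [h]
  rintro w ⟨s, hw⟩
  refine ⟨(s, 0, 0), hw, fun i => ?_⟩
  have h := (hC i).zero_mem
  rw [← join_zero] at h
  exact h

theorem implements_canonicalLocal (hP : ∀ i, IsLinearDifferential (P i))
    (hK : ∀ i, IsLinearDifferential (K i)) (hN : hidden P ⊆ manifest (interconnect K))
    (hKP : manifest (interconnect K) ⊆ manifest (plantInterconnect P)) :
    Implements P K (canonicalLocal P K) := by
  refine Set.Subset.antisymm (fun w hw => ?_) ?_
  · obtain ⟨⟨s, c⟩, hs⟩ := hKP hw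
    obtain ⟨k, hk⟩ := hw
    -- The controllers copy the plant's own `s` and the `k` of the desired behavior; `w` itself is
    -- the witness.
    refine ⟨(s, c, fun e t => Fin.append (s e t) (k e t)), hs, fun i => ⟨w i, ?_, ?_⟩⟩
    · convert hs i using 2
      simp [join, connAt]
      rfl
    · convert hk i using 2
      simp [join, connAt]
      rfl
  · rintro w ⟨⟨s, c, p⟩, hw, hp⟩
    -- The local witnesses fit together globally because the two blocks of `p` are shared variables.
    choose w' hw' hk' using hp
    have h₁ : w' ∈ manifest (interconnect K) :=
      ⟨fun e t x => p e t (Fin.natAdd (ns e) x), hk'⟩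
    have h₂ : (w', (fun e t x => p e t (Fin.castAdd (nk e) x)), c) ∈ plantInterconnect P := hw'
    have h := add_mem_manifest_interconnect hK (hN (sub_mem_hidden hP hw h₂)) h₁
    rwa [sub_add_cancel] at h

end Control

end DistributedBehavior

theorem corollary1 (L : ℕ) (nw nc : Fin L → ℕ) (ns nk : Sym2 (Fin L) → ℕ)
    (P : ∀ i, Set (DistributedBehavior.Traj
      (Fin (nw i) ⊕ (DistributedBehavior.Conn ns i ⊕ Fin (nc i)))))
    (K : ∀ i, Set (DistributedBehavior.Traj (Fin (nw i) ⊕ DistributedBehavior.Conn nk i)))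
    (hP : ∀ i, DistributedBehavior.IsLinearDifferential (P i))
    (hK : ∀ i, DistributedBehavior.IsLinearDifferential (K i))
    (hstruct : ∀ i j, ns s(i, j) = 0 → nk s(i, j) = 0) :
    (DistributedBehavior.ImplementableViaDistributedControl P K ↔
      DistributedBehavior.Implements P K (DistributedBehavior.canonicalLocal P K)) ∧
    (DistributedBehavior.ImplementableViaDistributedControl P K ↔
      DistributedBehavior.hidden P ⊆
          DistributedBehavior.manifest (DistributedBehavior.interconnect K) ∧
        DistributedBehavior.manifest (DistributedBehavior.interconnect K) ⊆
          DistributedBehavior.manifest (DistributedBehavior.plantInterconnect P)) := by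
  have canonical : DistributedBehavior.Implements P K (DistributedBehavior.canonicalLocal P K) →
      DistributedBehavior.ImplementableViaDistributedControl P K := fun h =>
    ⟨fun e => ns e + nk e, fun i j hij => by
      simp [hij, hstruct i j hij], _,
      fun i => DistributedBehavior.isLinearDifferential_canonicalLocal (hP i) (hK i), h⟩
  have inclusions : DistributedBehavior.ImplementableViaDistributedControl P K →
      DistributedBehavior.hidden P ⊆
          DistributedBehavior.manifest (DistributedBehavior.interconnect K) ∧
        DistributedBehavior.manifest (DistributedBehavior.interconnect K) ⊆
          DistributedBehavior.manifest (DistributedBehavior.plantInterconnect P) := by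
    rintro ⟨np, -, C, hC, h⟩
    exact ⟨h.hidden_subset hC, h.subset_plant⟩
  have implements := fun h : _ ∧ _ =>
    DistributedBehavior.implements_canonicalLocal hP hK h.1 h.2
  exact ⟨⟨fun h => implements (inclusions h), canonical⟩,
    ⟨inclusions, fun h => canonical (implements h)⟩⟩
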